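/- Let $1 \le k \le n/4$, and let $G = (A, B, E)$ be a bipartite simple graph with $|A| = n$, $|B| = m$ that is a $(2k, 1/16)$-expander with left degree $d$: every vertex of $A$ has exactly $d$ neighbors in $B$, and every nonempty $S \subseteq A$ with $|S| \le 2k$ has a set of neighbors $\mathcal N(S)$ with $|\mathcal N(S)| > (1 - \tfrac{1}{16})\, d\, |S|$. Let $F \in \{0,1\}^{m \times n}$ be the adjacency matrix of $G$ and let $\Phi = F/d$. Let $\theta^* \in \mathbb R_+^n$ with $\|\theta^*\|_1 = L$, and let $\theta^{*(k)}$ be a best $k$-term approximation of $\theta^*$, that is, the vector obtained from $\theta^*$ by keeping $k$ coordinates of largest magnitude and setting the others to zero. For $g \in \mathbb R_+^m$ let $\mathbb P_g$ denote the law on $\mathbb Z_+^m$ of a vector with independent coordinates $y_j \sim \mathrm{Poisson}(g_j)$, where $\mathrm{Poisson}(0)$ is the point mass at $0$. Let $\Theta_L$ be a nonempty finite or countable set of vectors $\theta \in \mathbb R_+^n$ with $\|\theta\|_1 \le L$, and let $\mathrm{pen} : \Theta_L \to \mathbb R_+$ satisfy the Kraft inequality $\sum_{\theta \in \Theta_L}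 e^{-\mathrm{pen}(\theta)} \le 1$. Suppose that there is a constant $c > 0$ with $(\Phi\theta)_j \ge c$ for all $\theta \in \Theta_L$ and all $1 \le j \le m$. Given $y \sim \mathbb P_{\Phi\theta^*}$, let $\hat\theta = \hat\theta(y)$ be a penalized maximum likelihood estimator, $$\hat\theta(y) \in \operatorname*{arg\,min}_{\theta \in \Theta_L} \bigl[ -\log \mathbb P_{\Phi\theta}(y) + 2\,\mathrm{pen}(\theta) \bigr] \qquad \text{for every } y \in \mathbb Z_+^m .$$ Then the minimum below is attained, the expectation below is finite, and $$\mathbb E_{y \sim \mathbb P_{\Phi\theta^*}} \bigl\| \hat\theta(y) - \theta^* \bigr\|_1 \;\le\; 4\, \bigl\| \theta^* - \theta^{*(k)} \bigr\|_1 + 8 \sqrt{ L \, \min_{\theta \in \Theta_L} \left[ \frac{\|\theta^* - \theta\|_1^2}{c} + 2\,\mathrm{pen}(\theta) \right] } .$$ -/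

import Mathlib

open MeasureTheory ProbabilityTheory
open scoped NNReal ENNReal

namespace PoissonCS

/-- The set of neighbors `N(S)` of a set `S` of left vertices, in the bipartite simple graph with
left vertex set `Fin n`, right vertex set `Fin m` and edge set `E ⊆ Fin n × Fin m`. -/
def neighbors {n m : ℕ} (E : Finset (Fin n × Fin m)) (S : Finset (Fin n)) : Finset (Fin m) :=
  Finset.univ.filter fun j => ∃ i ∈ S, (i, j) ∈ E

/-- The bipartite simple graph `(Fin n, Fin m, E)` is a `(k, ε)`-expander with left degree `d`:
every left vertex has exactly `d` neighbors, and every nonempty set `S` of at most `k` left vertices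
has more than `(1 - ε) d |S|` neighbors. -/
structure IsExpander {n m : ℕ} (E : Finset (Fin n × Fin m)) (d k : ℕ) (ε : ℝ) : Prop where
  left_regular : ∀ i : Fin n, (neighbors E {i}).card = d
  expansion : ∀ S : Finset (Fin n), S.Nonempty → S.card ≤ k →
    (1 - ε) * d * S.card < ((neighbors E S).card : ℝ)

/-- The `m × n` adjacency matrix of a bipartite graph. -/
noncomputable def adjMatrix {n m : ℕ} (E : Finset (Fin n × Fin m)) : Matrix (Fin m) (Fin n) ℝ :=
  Matrix.of fun j i => if (i, j) ∈ E then 1 else 0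

/-- The normalized adjacency matrix `Φ = A / d`. -/
noncomputable def normAdjMatrix {n m : ℕ} (E : Finset (Fin n × Fin m)) (d : ℕ) :
    Matrix (Fin m) (Fin n) ℝ :=
  (d : ℝ)⁻¹ • adjMatrix E

/-- The `ℓ₁` norm on `ℝⁿ`. -/
def l1norm {n : ℕ} (u : Fin n → ℝ) : ℝ := ∑ i, |u i|

/-- `v` is a best `k`-term approximation of `u`: it keeps the `k` coordinates of `u` that are
largest in magnitude (ties broken in any way) and sets the others to zero. -/
def IsBestKTerm {n : ℕ} (k : ℕ) (u v : Fin n → ℝ) : Prop :=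
  ∃ S : Finset (Fin n), S.card = k ∧ (∀ i ∈ S, ∀ j, j ∉ S → |u j| ≤ |u i|) ∧
    v = fun i => if i ∈ S then u i else 0

/-- The law `P_g` on `ℕᵐ` of a vector with independent coordinates, the `j`-th one being Poisson
with mean `g j` (for `g` with nonnegative coordinates; mean `0` gives the point mass at `0`). -/
noncomputable def poissonLaw {m : ℕ} (g : Fin m → ℝ) : Measure (Fin m → ℕ) :=
  Measure.pi fun j => poissonMeasure (g j).toNNReal

/-- The penalized negative log-likelihood `- log P_{Φ θ}(y) + 2 pen(θ)`, extended-real valued so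
that `- log 0 = +∞`. -/
noncomputable def penNegLogLik {n m : ℕ} (Φ : Matrix (Fin m) (Fin n) ℝ)
    (θ : Fin n → ℝ) (p : ℝ≥0) (y : Fin m → ℕ) : EReal :=
  -ENNReal.log (poissonLaw (Φ.mulVec θ) {y}) + ((2 * (p : ℝ) : ℝ) : EReal)

/-- `θhat` is a penalized maximum likelihood estimator over `Θ`: for every observation `y`, the
estimate `θhat y` minimizes the penalized negative log-likelihood over `Θ`. -/
def IsPMLE {n m : ℕ} (Φ : Matrix (Fin m) (Fin n) ℝ) (Θ : Set (Fin n → ℝ)) (pen : Θ → ℝ≥0)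
    (θhat : (Fin m → ℕ) → Θ) : Prop :=
  ∀ y : Fin m → ℕ, ∀ θ : Θ,
    penNegLogLik Φ (θhat y) (pen (θhat y)) y ≤ penNegLogLik Φ θ (pen θ) y

/-- The `ℓ₁` loss `‖θhat(y) - θ*‖₁` as a function of the observation `y`. -/
def l1loss {n m : ℕ} {Θ : Set (Fin n → ℝ)} (θhat : (Fin m → ℕ) → Θ) (θstar : Fin n → ℝ)
    (y : Fin m → ℕ) : ℝ :=
  l1norm ((θhat y : Fin n → ℝ) - θstar)

/-- The expected `ℓ₁` risk of `θhat` when `y ∼ Poisson(Φ θ*)`. -/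
noncomputable def risk {n m : ℕ} (Φ : Matrix (Fin m) (Fin n) ℝ) {Θ : Set (Fin n → ℝ)}
    (θhat : (Fin m → ℕ) → Θ) (θstar : Fin n → ℝ) : ℝ :=
  ∫ y, l1loss θhat θstar y ∂(poissonLaw (Φ.mulVec θstar))

end PoissonCS

/-!
The proof combines a deterministic stability property of `Φ` with a Hellinger risk bound for
penalized maximum likelihood.

*Stability.* Let `z = θhat - θstar` and let `S` carry the `k` largest entries of `z`. Keeping, at
each neighbor of `S`, only the heaviest adjacent entry of `z` on `S`, the expansion property gives
`‖Φ z‖₁ ≥ (1 - 2ε) ‖z_S‖₁ - 2ε ‖z‖₁` with `ε = 1 / 16` (`IsExpander.sum_abs_le`): expansion, in the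
layer-cake form `IsExpander.sum_le_sum_neighbors`, makes the heaviest entries dominate, and few
edges run from outside `S` to the neighbors of `S` (`IsExpander.sum_card_inter_le`,
`block_sum_le`). Since `‖θhat‖₁ ≤ ‖θstar‖₁`, the error outside the support of the best `k`-term
approximation is controlled by the error inside it, so that
`‖z‖₁ ≤ 4 ‖θstar - θk‖₁ + 4 ‖Φ z‖₁` (`IsExpander.l1norm_sub_le`).

*Hellinger risk.* Write `f = Φ θstar`, `g = Φ θ` and `H²(f, g) = ∑ (√f j - √g j)²`, so that
`exp (-H² / 2)` is the Hellinger affinity of the two Poisson laws. The root likelihood ratios,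
divided by the affinity and weighted by `exp (-pen θ)`, have means adding up to at most `1` by the
Kraft inequality. The minimizing property of `θhat` bounds `H²(f, Φ θhat)` by twice the logarithm
of such a weighted ratio, plus the log-likelihood ratio of `f` to any competitor `g`, plus
`2 pen θ`. Both logarithms are bounded by `log x ≤ x - 1`, the second after dividing the likelihood
ratio by its mean `exp (∑ (f j - g j)² / g j)`; in this way the Kullback-Leibler divergence is never
needed. Taking expectations gives `E H²(f, Φ θhat) ≤ ∑ (f j - g j)² / g j + 2 pen θ`
(`lintegral_sqrtDistSq_le`), where the sum is at most `‖θstar - θ‖₁² / c` because `g ≥ c` and `Φ`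
does not increase the `ℓ₁` norm.

*Conclusion.* By Cauchy-Schwarz `‖Φ z‖₁² ≤ 4 L H²` (`l1norm_sub_sq_le`), and Jensen's inequality
yields `E ‖Φ z‖₁ ≤ 2 √(L M)`. The minimum `M` is attained because the Kraft inequality leaves only
finitely many `θ` with penalty below any given level.
-/

namespace PoissonCS

/-! ### Expander graphs and the `ℓ₁` norm -/

section Expander

variable {n m : ℕ} {E : Finset (Fin n × Fin m)}

theorem mem_neighbors {S : Finset (Fin n)} {j : Fin m} :
    j ∈ neighbors E S ↔ ∃ i ∈ S, (i, j) ∈ E := by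
  simp [neighbors]

theorem mem_neighbors_singleton {i : Fin n} {j : Fin m} :
    j ∈ neighbors E {i} ↔ (i, j) ∈ E := by
  simp [neighbors]

theorem neighbors_mono {S T : Finset (Fin n)} (h : S ⊆ T) : neighbors E S ⊆ neighbors E T := by
  intro j hj
  obtain ⟨i, hi, hij⟩ := mem_neighbors.1 hj
  exact mem_neighbors.2 ⟨i, h hi, hij⟩

/-- A layer-cake form of the expansion property: if `M j` dominates the weights of all the vertices
of `T` adjacent to `j`, then the sum of `M` over the neighbors of `T` is at least `(1 - ε) d` times
the weight of `T`. -/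
theorem IsExpander.sum_le_sum_neighbors {d K : ℕ} {ε : ℝ} (hE : IsExpander E d K ε)
    (T : Finset (Fin n)) (hT : T.card ≤ K) (a : Fin n → ℝ) (M : Fin m → ℝ)
    (ha : ∀ i ∈ T, 0 ≤ a i) (hM : ∀ i ∈ T, ∀ j, (i, j) ∈ E → a i ≤ M j) :
    (1 - ε) * d * ∑ i ∈ T, a i ≤ ∑ j ∈ neighbors E T, M j := by
  induction T using Finset.strongInduction generalizing a M with
  | H T ih =>
    rcases T.eq_empty_or_nonempty with rfl | hne
    · simp [neighbors]
    -- Peel off the layer of height `a i₀ = min a`, which contributes `a i₀ * |N(T)|`.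
    obtain ⟨i₀, hi₀, hmin⟩ := T.exists_min_image a hne
    have hsub : T.erase i₀ ⊆ T := T.erase_subset i₀
    have key := ih (T.erase i₀) (Finset.erase_ssubset hi₀)
      ((Finset.card_le_card hsub).trans hT) (fun i => a i - a i₀) (fun j => M j - a i₀)
      (fun i hi => sub_nonneg.2 (hmin i (hsub hi)))
      (fun i hi j hij => sub_le_sub_right (hM i (hsub hi) j hij) _)
    have h1 : ∑ i ∈ T.erase i₀, (a i - a i₀) = ∑ i ∈ T, a i - T.card * a i₀ := by
      rw [Finset.sum_erase _ (by simp)]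
      simp [Finset.sum_sub_distrib]
    have h2 : ∑ j ∈ neighbors E (T.erase i₀), (M j - a i₀) ≤ ∑ j ∈ neighbors E T, (M j - a i₀) := by
      refine Finset.sum_le_sum_of_subset_of_nonneg (neighbors_mono hsub) fun j hj _ => ?_
      obtain ⟨i, hi, hij⟩ := mem_neighbors.1 hj
      exact sub_nonneg.2 ((hmin i hi).trans (hM i hi j hij))
    have h3 : ∑ j ∈ neighbors E T, (M j - a i₀)
        = ∑ j ∈ neighbors E T, M j - (neighbors E T).card * a i₀ := by
      simp [Finset.sum_sub_distrib]
    have h4 := mul_le_mul_of_nonneg_right (hE.expansion T hne hT).le (ha i₀ hi₀)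
    rw [h1] at key
    rw [h3] at h2
    linarith

/-- The neighbors of `S` receive few edges from outside `S`. -/
theorem IsExpander.sum_card_inter_le {d k : ℕ} {ε : ℝ} (hε : 0 ≤ ε)
    (hE : IsExpander E d (2 * k) ε) {S W : Finset (Fin n)} (hSW : Disjoint S W)
    (hS : S.card ≤ k) (hW : W.card ≤ k) :
    ∑ i ∈ W, ((neighbors E {i} ∩ neighbors E S).card : ℝ) ≤ 2 * ε * d * k := by
  rcases (S ∪ W).eq_empty_or_nonempty with h0 | hne
  · have : W = ∅ := (Finset.union_eq_empty.1 h0).2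
    subst this
    simp only [Finset.sum_empty]
    positivity
  have hcard : (S ∪ W).card = S.card + W.card := Finset.card_union_of_disjoint hSW
  have hexp := hE.expansion (S ∪ W) hne (by omega)
  rw [hcard] at hexp
  have hsub : neighbors E (S ∪ W) ⊆
      neighbors E S ∪ W.biUnion fun i => neighbors E {i} \ neighbors E S := by
    intro j hj
    obtain ⟨i, hi, hij⟩ := mem_neighbors.1 hj
    by_cases hjS : j ∈ neighbors E S
    · exact Finset.mem_union_left _ hjS
    · rcases Finset.mem_union.1 hi with hi | hi
      · exact absurd (mem_neighbors.2 ⟨i, hi, hij⟩) hjS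
      · exact Finset.mem_union_right _ (Finset.mem_biUnion.2
          ⟨i, hi, Finset.mem_sdiff.2 ⟨mem_neighbors_singleton.2 hij, hjS⟩⟩)
  have h1 : ((neighbors E (S ∪ W)).card : ℝ) ≤
      (neighbors E S).card + ∑ i ∈ W, ((neighbors E {i} \ neighbors E S).card : ℝ) := by
    exact_mod_cast (Finset.card_le_card hsub).trans ((Finset.card_union_le _ _).trans
      (Nat.add_le_add_left Finset.card_biUnion_le _))
  have h2 : ((neighbors E S).card : ℝ) ≤ S.card * d := by
    have : neighbors E S ⊆ S.biUnion fun i => neighbors E {i} := by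
      intro j hj
      obtain ⟨i, hi, hij⟩ := mem_neighbors.1 hj
      exact Finset.mem_biUnion.2 ⟨i, hi, mem_neighbors_singleton.2 hij⟩
    have h := (Finset.card_le_card this).trans Finset.card_biUnion_le
    rw [Finset.sum_congr rfl fun i _ => hE.left_regular i] at h
    simp only [Finset.sum_const, smul_eq_mul] at h
    exact_mod_cast h
  have h3 : ∑ i ∈ W, ((neighbors E {i} \ neighbors E S).card : ℝ)
      = W.card * d - ∑ i ∈ W, ((neighbors E {i} ∩ neighbors E S).card : ℝ) := by
    rw [eq_sub_iff_add_eq, ← Finset.sum_add_distrib, ← nsmul_eq_mul, ← Finset.sum_const]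
    refine Finset.sum_congr rfl fun i _ => ?_
    rw [← hE.left_regular i, ← Nat.cast_add, Finset.card_sdiff_add_card_inter]
  have h4 : ε * d * ((S.card : ℝ) + W.card) ≤ ε * d * (k + k) := by
    have : (S.card : ℝ) ≤ k := by exact_mod_cast hS
    have : (W.card : ℝ) ≤ k := by exact_mod_cast hW
    gcongr
  push_cast at hexp
  linarith

/-- A finite set contains a subset of any prescribed size made of elements of largest value. -/
theorem exists_subset_card_eq_largest {ι : Type*} [DecidableEq ι] (a : ι → ℝ) (R : Finset ι)
    (t : ℕ) (ht : t ≤ R.card) :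
    ∃ W ⊆ R, W.card = t ∧ ∀ i ∈ W, ∀ j ∈ R \ W, a j ≤ a i := by
  induction t with
  | zero => exact ⟨∅, by simp, by simp, by simp⟩
  | succ t ih =>
    obtain ⟨W, hWR, hWt, hW⟩ := ih (by omega)
    have hne : (R \ W).Nonempty := by
      rw [← Finset.card_pos, Finset.card_sdiff_of_subset hWR]
      omega
    obtain ⟨x, hx, hmax⟩ := (R \ W).exists_max_image a hne
    obtain ⟨hxR, hxW⟩ := Finset.mem_sdiff.1 hx
    refine ⟨insert x W, Finset.insert_subset hxR hWR, by
      rw [Finset.card_insert_of_notMem hxW, hWt], fun i hi j hj => ?_⟩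
    have hj' : j ∈ R \ W := by
      simp only [Finset.mem_sdiff, Finset.mem_insert, not_or] at hj ⊢
      exact ⟨hj.1, hj.2.2⟩
    rcases Finset.mem_insert.1 hi with rfl | hi
    · exact hmax j hj'
    · exact hW i hi j hj'

/-- Splitting `R` into blocks of `k` elements in decreasing order of `a`, and comparing each block
with the preceding one: if the total `e`-mass of `k` elements of `R` is at most `C`, and `S` is a
block of `k` elements at which `a` is larger than on `R`, then `∑ i ∈ R, a i * e i` is at most
`C / k` times the sum of `a`. -/
theorem block_sum_le {ι : Type*} [DecidableEq ι] {a e : ι → ℝ} {k : ℕ} {C : ℝ}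
    (hk : 0 < k) (hC : 0 ≤ C) (ha : ∀ i, 0 ≤ a i) (he : ∀ i, 0 ≤ e i) (R : Finset ι)
    (hRC : ∀ W ⊆ R, W.card ≤ k → ∑ i ∈ W, e i ≤ C)
    (S : Finset ι) (hS : S.card = k) (hSR : ∀ i ∈ S, ∀ j ∈ R, a j ≤ a i) :
    k * ∑ i ∈ R, a i * e i ≤ C * (∑ i ∈ S, a i + ∑ i ∈ R, a i) := by
  induction R using Finset.strongInduction generalizing S with
  | H R ih =>
    have block : ∀ W ⊆ R, W.card ≤ k → k * ∑ i ∈ W, a i * e i ≤ C * ∑ i ∈ S, a i := by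
      intro W hWR hWk
      obtain ⟨s, hs, hmin⟩ := S.exists_min_image a (Finset.card_pos.1 (hS ▸ hk))
      have h1 : ∑ i ∈ W, a i * e i ≤ a s * C := by
        calc ∑ i ∈ W, a i * e i ≤ ∑ i ∈ W, a s * e i := Finset.sum_le_sum fun i hi =>
              mul_le_mul_of_nonneg_right (hSR s hs i (hWR hi)) (he i)
          _ = a s * ∑ i ∈ W, e i := by rw [Finset.mul_sum]
          _ ≤ a s * C := mul_le_mul_of_nonneg_left (hRC W hWR hWk) (ha s)
      have h2 : k * a s ≤ ∑ i ∈ S, a i := by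
        rw [← hS, ← nsmul_eq_mul]
        exact Finset.card_nsmul_le_sum _ _ _ hmin
      calc k * ∑ i ∈ W, a i * e i ≤ k * (a s * C) := by gcongr
        _ = C * (k * a s) := by ring
        _ ≤ C * ∑ i ∈ S, a i := by gcongr
    rcases le_total R.card k with hR | hR
    · refine (block R subset_rfl hR).trans ?_
      have := Finset.sum_nonneg fun i (_ : i ∈ R) => ha i
      gcongr
      linarith
    · obtain ⟨W, hWR, hWk, hW⟩ := exists_subset_card_eq_largest a R k hR
      have h1 := block W hWR hWk.le
      have h2 := ih (R \ W) (Finset.sdiff_ssubset hWR (Finset.card_pos.1 (hWk ▸ hk)))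
        (fun V hV => hRC V (hV.trans Finset.sdiff_subset)) W hWk hW
      rw [← Finset.sum_sdiff hWR, ← Finset.sum_sdiff (f := a) hWR]
      linarith

theorem adjMatrix_mulVec (u : Fin n → ℝ) (j : Fin m) :
    (adjMatrix E).mulVec u j = ∑ i, if (i, j) ∈ E then u i else 0 := by
  simp [adjMatrix, Matrix.mulVec, dotProduct]

theorem normAdjMatrix_mulVec (d : ℕ) (u : Fin n → ℝ) (j : Fin m) :
    (normAdjMatrix E d).mulVec u j = (d : ℝ)⁻¹ * ∑ i, if (i, j) ∈ E then u i else 0 := by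
  simp [normAdjMatrix, Matrix.smul_mulVec, adjMatrix_mulVec]

/-- The matrix `Φ` of an expander does not shrink much the part of a vector carried by its `k`
largest entries, up to a small multiple of the norm of the whole vector. -/
theorem IsExpander.sum_abs_le {d k : ℕ} {ε : ℝ} (hε : 0 ≤ ε) (hk : 0 < k) (hd : 0 < d)
    (hE : IsExpander E d (2 * k) ε) (u : Fin n → ℝ) (S : Finset (Fin n)) (hS : S.card = k)
    (hmax : ∀ i ∈ S, ∀ j, j ∉ S → |u j| ≤ |u i|) :
    (1 - 2 * ε) * ∑ i ∈ S, |u i| ≤ l1norm ((normAdjMatrix E d).mulVec u) + 2 * ε * l1norm u := by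
  have hd' : (0 : ℝ) < d := by exact_mod_cast hd
  have hk' : (0 : ℝ) < k := by exact_mod_cast hk
  -- `p j` is a heaviest vertex of `S` adjacent to `j`.
  have hp : ∀ j : Fin m, ∃ p : Fin n, j ∈ neighbors E S →
      (p, j) ∈ E ∧ ∀ i ∈ S, (i, j) ∈ E → |u i| ≤ |u p| := by
    intro j
    by_cases hj : j ∈ neighbors E S
    · obtain ⟨i₀, hi₀, hij₀⟩ := mem_neighbors.1 hj
      obtain ⟨p, hp, hpmax⟩ := (S.filter fun i => (i, j) ∈ E).exists_max_image (fun i => |u i|)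
        ⟨i₀, by simp [hi₀, hij₀]⟩
      exact ⟨p, fun _ => ⟨(Finset.mem_filter.1 hp).2,
        fun i hi hij => hpmax i (Finset.mem_filter.2 ⟨hi, hij⟩)⟩⟩
    · have hn : 0 < S.card := hS ▸ hk
      obtain ⟨i, _⟩ := Finset.card_pos.1 hn
      exact ⟨i, fun h => absurd h hj⟩
  choose p hp using hp
  have h1 : (1 - ε) * d * ∑ i ∈ S, |u i| ≤ ∑ j ∈ neighbors E S, |u (p j)| :=
    hE.sum_le_sum_neighbors S (by omega) (fun i => |u i|) (fun j => |u (p j)|)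
      (fun i _ => abs_nonneg _)
      (fun i hi j hij => (hp j (mem_neighbors.2 ⟨i, hi, hij⟩)).2 i hi hij)
  have h2 : ∀ j ∈ neighbors E S, 2 * |u (p j)| - ∑ i, (if (i, j) ∈ E then |u i| else 0)
      ≤ |∑ i, if (i, j) ∈ E then u i else 0| := by
    intro j hj
    rw [← Finset.add_sum_erase _ _ (Finset.mem_univ (p j)),
      ← Finset.add_sum_erase _ (fun i => if (i, j) ∈ E then u i else 0) (Finset.mem_univ (p j))]
    simp only [(hp j hj).1, if_true]
    have h3 : |∑ i ∈ Finset.univ.erase (p j), if (i, j) ∈ E then u i else 0|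
        ≤ ∑ i ∈ Finset.univ.erase (p j), if (i, j) ∈ E then |u i| else 0 := by
      refine (Finset.abs_sum_le_sum_abs _ _).trans (Finset.sum_le_sum fun i _ => ?_)
      split_ifs <;> simp
    have h4 := abs_sub_abs_le_abs_sub (u (p j))
      (-∑ i ∈ Finset.univ.erase (p j), if (i, j) ∈ E then u i else 0)
    rw [abs_neg, sub_neg_eq_add] at h4
    linarith
  have h3 : ∑ j ∈ neighbors E S, ∑ i, (if (i, j) ∈ E then |u i| else 0)
      = ∑ i, |u i| * ((neighbors E {i} ∩ neighbors E S).card : ℝ) := by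
    rw [Finset.sum_comm]
    refine Finset.sum_congr rfl fun i _ => ?_
    rw [← Finset.sum_filter, Finset.sum_const, nsmul_eq_mul, mul_comm]
    congr 3
    ext j
    simp [mem_neighbors_singleton, and_comm]
  have h4 : ∑ i ∈ S, |u i| * ((neighbors E {i} ∩ neighbors E S).card : ℝ)
      = d * ∑ i ∈ S, |u i| := by
    rw [Finset.mul_sum]
    refine Finset.sum_congr rfl fun i hi => ?_
    rw [Finset.inter_eq_left.2 (neighbors_mono (Finset.singleton_subset_iff.2 hi)),
      hE.left_regular i, mul_comm]
  have h5 : k * ∑ i ∈ Sᶜ, |u i| * ((neighbors E {i} ∩ neighbors E S).card : ℝ)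
      ≤ 2 * ε * d * k * (∑ i ∈ S, |u i| + ∑ i ∈ Sᶜ, |u i|) :=
    block_sum_le hk (by positivity) (fun i => abs_nonneg _) (fun i => Nat.cast_nonneg _) Sᶜ
      (fun W hW hWk => hE.sum_card_inter_le hε
        (disjoint_compl_right.mono_right hW) hS.le hWk)
      S hS (fun i hi j hj => hmax i hi j (Finset.mem_compl.1 hj))
  rw [Finset.sum_add_sum_compl] at h5
  have h6 : ∑ i ∈ Sᶜ, |u i| * ((neighbors E {i} ∩ neighbors E S).card : ℝ)
      ≤ 2 * ε * d * ∑ i, |u i| := by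
    refine le_of_mul_le_mul_left ?_ hk'
    linarith
  have h7 : d * l1norm ((normAdjMatrix E d).mulVec u)
      = ∑ j, |∑ i, if (i, j) ∈ E then u i else 0| := by
    simp only [l1norm, normAdjMatrix_mulVec, abs_mul, abs_inv, Nat.abs_cast, ← Finset.mul_sum]
    rw [mul_inv_cancel_left₀ hd'.ne']
  have h8 : ∑ j ∈ neighbors E S, |∑ i, if (i, j) ∈ E then u i else 0|
      ≤ ∑ j, |∑ i, if (i, j) ∈ E then u i else 0| :=
    Finset.sum_le_sum_of_subset_of_nonneg (Finset.subset_univ _) fun _ _ _ => abs_nonneg _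
  have h9 := Finset.sum_le_sum h2
  rw [Finset.sum_sub_distrib, ← Finset.mul_sum, h3, ← Finset.sum_add_sum_compl S, h4] at h9
  refine le_of_mul_le_mul_left ?_ hd'
  rw [mul_add, h7, l1norm]
  linarith

/-- Stability of expander-based recovery: if `v` has no larger `ℓ₁` norm than `u`, then `v` is
close to `u` as soon as `u` is nearly `k`-sparse and `Φ v` is close to `Φ u`. -/
theorem IsExpander.l1norm_sub_le {d k : ℕ} (hk : 0 < k) (hkn : k ≤ n) (hd : 0 < d)
    (hE : IsExpander E d (2 * k) (1 / 16)) {u v uk : Fin n → ℝ} (huk : IsBestKTerm k u uk)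
    (hv : l1norm v ≤ l1norm u) :
    l1norm (v - u) ≤ 4 * l1norm (u - uk) + 4 * l1norm ((normAdjMatrix E d).mulVec (v - u)) := by
  obtain ⟨T, hT, -, rfl⟩ := huk
  obtain ⟨S, -, hS, hSmax⟩ := exists_subset_card_eq_largest (fun i => |(v - u) i|) Finset.univ k
    (by simpa using hkn)
  have hS' : ∀ i ∈ S, ∀ j, j ∉ S → |(v - u) j| ≤ |(v - u) i| := fun i hi j hj =>
    hSmax i hi j (by simpa using hj)
  have h1 := hE.sum_abs_le (by norm_num) hk hd (v - u) S hS hS'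
  -- Since `S` carries the `k` largest entries of `v - u`, it carries more mass than `T`.
  have h2 : ∑ i ∈ T, |(v - u) i| ≤ ∑ i ∈ S, |(v - u) i| := by
    have hcard : (T \ S).card = (S \ T).card := Finset.card_sdiff_comm (hT.trans hS.symm)
    have hTS := Finset.sum_inter_add_sum_sdiff T S fun i => |(v - u) i|
    have hST := Finset.sum_inter_add_sum_sdiff S T fun i => |(v - u) i|
    rw [Finset.inter_comm] at hST
    suffices ∑ i ∈ T \ S, |(v - u) i| ≤ ∑ i ∈ S \ T, |(v - u) i| by linarith
    rcases (S \ T).eq_empty_or_nonempty with h0 | hne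
    · rw [h0, Finset.card_empty, Finset.card_eq_zero] at hcard
      rw [h0, hcard]
    · obtain ⟨s, hs, hmin⟩ := (S \ T).exists_min_image (fun i => |(v - u) i|) hne
      calc ∑ i ∈ T \ S, |(v - u) i| ≤ (T \ S).card • |(v - u) s| :=
            Finset.sum_le_card_nsmul _ _ _ fun i hi =>
              hS' s (Finset.mem_sdiff.1 hs).1 i (Finset.mem_sdiff.1 hi).2
        _ = (S \ T).card • |(v - u) s| := by rw [hcard]
        _ ≤ _ := Finset.card_nsmul_le_sum _ _ _ hmin
  have h3 : l1norm (u - fun i => if i ∈ T then u i else 0) = ∑ i ∈ Tᶜ, |u i| := by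
    rw [l1norm, ← Finset.sum_add_sum_compl T, Finset.sum_eq_zero, zero_add]
    · exact Finset.sum_congr rfl fun i hi => by simp [Finset.mem_compl.1 hi]
    · exact fun i hi => by simp [hi]
  have h4 : ∑ i ∈ T, (|u i| - |(v - u) i|) ≤ ∑ i ∈ T, |v i| :=
    Finset.sum_le_sum fun i _ => by
      have := abs_sub_abs_le_abs_sub (u i) (v i)
      rw [abs_sub_comm] at this
      simp only [Pi.sub_apply]
      linarith
  have h5 : ∑ i ∈ Tᶜ, (|(v - u) i| - |u i|) ≤ ∑ i ∈ Tᶜ, |v i| :=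
    Finset.sum_le_sum fun i _ => by
      have := abs_sub (v i) (u i)
      simp only [Pi.sub_apply]
      linarith
  rw [Finset.sum_sub_distrib] at h4 h5
  have hu := Finset.sum_add_sum_compl T fun i => |u i|
  have hvs := Finset.sum_add_sum_compl T fun i => |v i|
  have hvu := Finset.sum_add_sum_compl T fun i => |(v - u) i|
  rw [h3]
  have h6 : 0 ≤ l1norm ((normAdjMatrix E d).mulVec (v - u)) :=
    Finset.sum_nonneg fun _ _ => abs_nonneg _
  have h7 : 0 ≤ ∑ i ∈ Tᶜ, |u i| := Finset.sum_nonneg fun _ _ => abs_nonneg _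
  simp only [l1norm] at *
  -- These inequalities combine to the bound with constants `14 / 5` and `16 / 5`, both at most `4`.
  linarith

theorem IsExpander.sum_ite_eq {d K : ℕ} {ε : ℝ} (hE : IsExpander E d K ε) (x : ℝ) (i : Fin n) :
    ∑ j : Fin m, (if (i, j) ∈ E then x else 0) = d * x := by
  rw [← Finset.sum_filter, Finset.sum_const, nsmul_eq_mul, ← hE.left_regular i]
  congr 3
  ext j
  simp [mem_neighbors_singleton]

theorem IsExpander.sum_mulVec {d K : ℕ} {ε : ℝ} (hE : IsExpander E d K ε) (hd : 0 < d)
    (u : Fin n → ℝ) : ∑ j, (normAdjMatrix E d).mulVec u j = ∑ i, u i := by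
  simp only [normAdjMatrix_mulVec, ← Finset.mul_sum]
  rw [Finset.sum_comm]
  simp only [hE.sum_ite_eq, ← Finset.mul_sum]
  rw [inv_mul_cancel_left₀ (by exact_mod_cast hd.ne')]

theorem abs_mulVec_le (d : ℕ) (u : Fin n → ℝ) (j : Fin m) :
    |(normAdjMatrix E d).mulVec u j| ≤ (normAdjMatrix E d).mulVec (fun i => |u i|) j := by
  rw [normAdjMatrix_mulVec, normAdjMatrix_mulVec, abs_mul, abs_of_nonneg (by positivity)]
  gcongr
  refine (Finset.abs_sum_le_sum_abs _ _).trans (Finset.sum_le_sum fun i _ => ?_)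
  split_ifs <;> simp

theorem IsExpander.l1norm_mulVec_le {d K : ℕ} {ε : ℝ} (hE : IsExpander E d K ε) (hd : 0 < d)
    (u : Fin n → ℝ) : l1norm ((normAdjMatrix E d).mulVec u) ≤ l1norm u :=
  (Finset.sum_le_sum fun j _ => abs_mulVec_le d u j).trans
    (hE.sum_mulVec hd _).le

theorem IsExpander.degree_pos {d K : ℕ} {ε : ℝ} (hE : IsExpander E d K ε)
    (hK : 1 ≤ K) (hn : 0 < n) : 0 < d := by
  have h := hE.expansion {⟨0, hn⟩} (by simp) (by simpa using hK)
  rw [hE.left_regular] at h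
  simp only [Finset.card_singleton, Nat.cast_one, mul_one] at h
  rcases Nat.eq_zero_or_pos d with rfl | hd
  · simp at h
  · exact hd

end Expander

/-! ### Exponential moments of Poisson vectors -/

instance isProbabilityMeasure_poissonLaw {m : ℕ} (g : Fin m → ℝ) :
    IsProbabilityMeasure (poissonLaw g) := by
  unfold poissonLaw
  infer_instance

theorem hasSum_poisson_exp (r : ℝ) (a : ℝ) :
    HasSum (fun k : ℕ => Real.exp (-r) * r ^ k / (k.factorial : ℝ) * Real.exp (a * k))
      (Real.exp (r * (Real.exp a - 1))) := by
  have h := (NormedSpace.expSeries_div_hasSum_exp (r * Real.exp a)).mul_left (Real.exp (-r))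
  rw [← Real.exp_eq_exp_ℝ, ← Real.exp_add] at h
  convert! h using 2 with k
  · rw [mul_pow, ← Real.exp_nat_mul, mul_comm a]
    ring
  · ring

theorem integrable_exp_poissonMeasure (r : ℝ≥0) (a b : ℝ) :
    Integrable (fun k : ℕ => Real.exp (a * k + b)) (poissonMeasure r) := by
  simp only [Real.exp_add]
  refine Integrable.mul_const ?_ _
  rw [integrable_poissonMeasure_iff]
  simpa only [Real.norm_eq_abs, Real.abs_exp] using (hasSum_poisson_exp r a).summable

theorem integral_exp_poissonMeasure (r : ℝ≥0) (a b : ℝ) :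
    ∫ k : ℕ, Real.exp (a * k + b) ∂(poissonMeasure r) = Real.exp (r * (Real.exp a - 1) + b) := by
  simp only [Real.exp_add]
  rw [integral_mul_const, integral_poissonMeasure]
  simp only [smul_eq_mul]
  rw [(hasSum_poisson_exp r a).tsum_eq]

/-- The exponential moments of a vector with independent Poisson coordinates. -/
theorem lintegral_exp_poissonLaw {m : ℕ} {f : Fin m → ℝ} (hf : ∀ j, 0 ≤ f j) (a b : Fin m → ℝ) :
    ∫⁻ y, ENNReal.ofReal (Real.exp (∑ j, (a j * y j + b j))) ∂(poissonLaw f)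
      = ENNReal.ofReal (Real.exp (∑ j, (f j * (Real.exp (a j) - 1) + b j))) := by
  have hint : Integrable (fun y : Fin m → ℕ => ∏ j, Real.exp (a j * y j + b j))
      (poissonLaw f) :=
    Integrable.fintype_prod (f := fun j (k : ℕ) => Real.exp (a j * k + b j))
      fun j => integrable_exp_poissonMeasure _ (a j) (b j)
  simp only [Real.exp_sum]
  rw [← ofReal_integral_eq_lintegral_ofReal hint
    (Filter.Eventually.of_forall fun y => Finset.prod_nonneg fun j _ => (Real.exp_pos _).le)]
  congr 1
  rw [poissonLaw, integral_fintype_prod_eq_prod (fun j (k : ℕ) => Real.exp (a j * k + b j))]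
  refine Finset.prod_congr rfl fun j _ => ?_
  rw [integral_exp_poissonMeasure, Real.coe_toNNReal _ (hf j)]

/-! ### Likelihood ratios -/

/-- The Poisson log-likelihood of the mean vector `g` at `y`, up to a term depending only on `y`.
Where `g j = 0` the convention `log 0 = 0` makes the `j`-th term vanish, which is the correct value
for almost every `y` drawn from the Poisson law of mean `g`. -/
noncomputable def logLik {m : ℕ} (g : Fin m → ℝ) (y : Fin m → ℕ) : ℝ :=
  ∑ j, (y j * Real.log (g j) - g j)

/-- The squared `ℓ₂` distance between the square roots of two mean vectors. It equals
`-2 log` of the Hellinger affinity of the corresponding Poisson laws. -/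
noncomputable def sqrtDistSq {m : ℕ} (f g : Fin m → ℝ) : ℝ :=
  ∑ j, (√(f j) - √(g j)) ^ 2

/-- The chi-square-type divergence `∑ (f j - g j)² / g j` of two mean vectors. It equals the
logarithm of the second moment of the likelihood ratio of the corresponding Poisson laws. -/
noncomputable def chiSq {m : ℕ} (f g : Fin m → ℝ) : ℝ :=
  ∑ j, (f j - g j) ^ 2 / g j

theorem sqrtDistSq_nonneg {m : ℕ} (f g : Fin m → ℝ) : 0 ≤ sqrtDistSq f g :=
  Finset.sum_nonneg fun _ _ => sq_nonneg _

theorem chiSq_nonneg {m : ℕ} {f g : Fin m → ℝ} (hg : ∀ j, 0 < g j) : 0 ≤ chiSq f g :=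
  Finset.sum_nonneg fun j _ => div_nonneg (sq_nonneg _) (hg j).le

/-- The Hellinger affinity of two Poisson vectors, normalized to `1`. -/
theorem lintegral_sqrt_ratio {m : ℕ} {f g : Fin m → ℝ} (hf : ∀ j, 0 ≤ f j) (hg : ∀ j, 0 < g j) :
    ∫⁻ y, ENNReal.ofReal (Real.exp ((logLik g y - logLik f y) / 2 + sqrtDistSq f g / 2))
      ∂(poissonLaw f) = 1 := by
  have h : ∀ y : Fin m → ℕ, (logLik g y - logLik f y) / 2 + sqrtDistSq f g / 2
      = ∑ j, ((Real.log (g j) - Real.log (f j)) / 2 * y j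
        + ((f j - g j) / 2 + (√(f j) - √(g j)) ^ 2 / 2)) := by
    intro y
    rw [logLik, logLik, sqrtDistSq, ← Finset.sum_sub_distrib, Finset.sum_div, Finset.sum_div,
      ← Finset.sum_add_distrib]
    exact Finset.sum_congr rfl fun j _ => by ring
  simp only [h]
  rw [lintegral_exp_poissonLaw hf, Finset.sum_eq_zero, Real.exp_zero, ENNReal.ofReal_one]
  intro j _
  have hmul : f j * Real.exp ((Real.log (g j) - Real.log (f j)) / 2) = √(f j) * √(g j) := by
    rcases (hf j).eq_or_lt with h0 | h0
    · simp [← h0]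
    · rw [sub_div, Real.exp_sub, Real.exp_half, Real.exp_half, Real.exp_log (hg j),
        Real.exp_log h0, mul_div_left_comm, Real.div_sqrt, mul_comm]
  have h1 := Real.sq_sqrt (hf j)
  have h2 := Real.sq_sqrt (hg j).le
  rw [mul_sub, hmul]
  linear_combination h1 / 2 + h2 / 2

/-- The second moment of the likelihood ratio of two Poisson vectors, normalized to `1`. -/
theorem lintegral_ratio {m : ℕ} {f g : Fin m → ℝ} (hf : ∀ j, 0 ≤ f j) (hg : ∀ j, 0 < g j) :
    ∫⁻ y, ENNReal.ofReal (Real.exp (logLik f y - logLik g y - chiSq f g)) ∂(poissonLaw f) = 1 := by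
  have h : ∀ y : Fin m → ℕ, logLik f y - logLik g y - chiSq f g
      = ∑ j, ((Real.log (f j) - Real.log (g j)) * y j
        + (g j - f j - (f j - g j) ^ 2 / g j)) := by
    intro y
    rw [logLik, logLik, chiSq, ← Finset.sum_sub_distrib, ← Finset.sum_sub_distrib]
    exact Finset.sum_congr rfl fun j _ => by ring
  simp only [h]
  rw [lintegral_exp_poissonLaw hf, Finset.sum_eq_zero, Real.exp_zero, ENNReal.ofReal_one]
  intro j _
  have hmul : f j * Real.exp (Real.log (f j) - Real.log (g j)) = f j * (f j / g j) := by
    rcases (hf j).eq_or_lt with h0 | h0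
    · simp [← h0]
    · rw [Real.exp_sub, Real.exp_log (hg j), Real.exp_log h0]
  have := (hg j).ne'
  rw [mul_sub, hmul]
  field_simp
  ring

/-! ### The risk of penalized maximum likelihood -/

/-- The Li-Barron bound: a selector minimizing the penalized negative log-likelihood has Hellinger
risk bounded by the best compromise between divergence and penalty. -/
theorem lintegral_sqrtDistSq_le {m : ℕ} {ι : Type*} [Countable ι] {f : Fin m → ℝ}
    (hf : ∀ j, 0 ≤ f j) (g : ι → Fin m → ℝ) (hg : ∀ i j, 0 < g i j) (pen : ι → ℝ≥0)
    (hKraft : ∑' i, ENNReal.ofReal (Real.exp (-(pen i : ℝ))) ≤ 1) (s : (Fin m → ℕ) → ι)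
    (hs : ∀ y i, 2 * (pen (s y) : ℝ) - logLik (g (s y)) y ≤ 2 * (pen i : ℝ) - logLik (g i) y)
    (i : ι) :
    ∫⁻ y, ENNReal.ofReal (sqrtDistSq f (g (s y))) ∂(poissonLaw f)
      ≤ ENNReal.ofReal (chiSq f (g i) + 2 * (pen i : ℝ)) := by
  -- `X i' y` is the normalized root likelihood ratio, of mean `1`, weighted by `exp (-pen i')`.
  let X : ι → (Fin m → ℕ) → ℝ≥0∞ := fun i' y => ENNReal.ofReal (Real.exp (-(pen i' : ℝ))) *
    ENNReal.ofReal (Real.exp ((logLik (g i') y - logLik f y) / 2 + sqrtDistSq f (g i') / 2))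
  let R : (Fin m → ℕ) → ℝ≥0∞ := fun y =>
    ENNReal.ofReal (Real.exp (logLik f y - logLik (g i) y - chiSq f (g i)))
  have hX : ∫⁻ y, ∑' i', X i' y ∂(poissonLaw f) ≤ 1 := by
    rw [lintegral_tsum fun i' => (measurable_of_countable _).aemeasurable]
    refine le_trans (le_of_eq (tsum_congr fun i' => ?_)) hKraft
    rw [lintegral_const_mul _ (measurable_of_countable _), lintegral_sqrt_ratio hf (hg i'), mul_one]
  have hR : ∫⁻ y, R y ∂(poissonLaw f) = 1 := lintegral_ratio hf (hg i)
  have hM : 0 ≤ chiSq f (g i) + 2 * (pen i : ℝ) :=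
    add_nonneg (chiSq_nonneg (hg i)) (by positivity)
  have hpt : ∀ y, ENNReal.ofReal (sqrtDistSq f (g (s y))) + 3
      ≤ 2 * ∑' i', X i' y + R y + ENNReal.ofReal (chiSq f (g i) + 2 * (pen i : ℝ)) := by
    intro y
    refine le_trans ?_ (add_le_add_left (add_le_add_left
      (mul_le_mul_right (ENNReal.le_tsum (s y)) 2) _) _)
    simp only [X, R]
    rw [← ENNReal.ofReal_mul (Real.exp_pos _).le, ← Real.exp_add,
      show (2 : ℝ≥0∞) = ENNReal.ofReal 2 by simp, show (3 : ℝ≥0∞) = ENNReal.ofReal 3 by simp,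
      ← ENNReal.ofReal_mul (by norm_num),
      ← ENNReal.ofReal_add (sqrtDistSq_nonneg _ _) (by norm_num),
      ← ENNReal.ofReal_add (by positivity) (by positivity),
      ← ENNReal.ofReal_add (by positivity) hM]
    refine ENNReal.ofReal_le_ofReal ?_
    -- Both exponentials are bounded below by `1 + x ≤ exp x`.
    have h1 := Real.add_one_le_exp (-(pen (s y) : ℝ) +
      ((logLik (g (s y)) y - logLik f y) / 2 + sqrtDistSq f (g (s y)) / 2))
    have h2 := Real.add_one_le_exp (logLik f y - logLik (g i) y - chiSq f (g i))
    have h3 := hs y i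
    linarith
  have hI := lintegral_mono (μ := poissonLaw f) hpt
  rw [lintegral_add_right _ measurable_const, lintegral_add_right _ measurable_const,
    lintegral_add_right _ (measurable_of_countable _),
    lintegral_const_mul _ (measurable_of_countable _), hR] at hI
  simp only [lintegral_const, measure_univ, mul_one] at hI
  have hI' := hI.trans (add_le_add_left (add_le_add_left (mul_le_mul_right hX 2) 1) _)
  rw [mul_one, show (2 : ℝ≥0∞) + 1 = 3 by norm_num, add_comm (3 : ℝ≥0∞)] at hI'
  exact (ENNReal.add_le_add_iff_right (by norm_num)).1 hI'

theorem poissonLaw_singleton {m : ℕ} {g : Fin m → ℝ} (hg : ∀ j, 0 < g j) (y : Fin m → ℕ) :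
    poissonLaw g {y} = ENNReal.ofReal
      (Real.exp (logLik g y - ∑ j, Real.log ((y j).factorial : ℝ))) := by
  rw [poissonLaw, Measure.pi_singleton, logLik, ← Finset.sum_sub_distrib, Real.exp_sum,
    ENNReal.ofReal_prod_of_nonneg fun j _ => (Real.exp_pos _).le]
  refine Finset.prod_congr rfl fun j _ => ?_
  rw [poissonMeasure_singleton, Real.coe_toNNReal _ (hg j).le]
  congr 1
  rw [Real.exp_sub, Real.exp_sub, Real.exp_log (by positivity), Real.exp_nat_mul,
    Real.exp_log (hg j), Real.exp_neg]
  ring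

/-- The defining inequality of a penalized maximum likelihood estimator, in terms of the reduced
log-likelihood. -/
theorem IsPMLE.logLik_le {n m : ℕ} {Φ : Matrix (Fin m) (Fin n) ℝ} {Θ : Set (Fin n → ℝ)}
    {pen : Θ → ℝ≥0} {θhat : (Fin m → ℕ) → Θ} (h : IsPMLE Φ Θ pen θhat)
    (hpos : ∀ θ ∈ Θ, ∀ j, 0 < Φ.mulVec θ j) (y : Fin m → ℕ) (θ : Θ) :
    2 * (pen (θhat y) : ℝ) - logLik (Φ.mulVec (θhat y)) y
      ≤ 2 * (pen θ : ℝ) - logLik (Φ.mulVec θ) y := by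
  have h1 := h y θ
  simp only [penNegLogLik] at h1
  rw [poissonLaw_singleton (hpos _ θ.2), poissonLaw_singleton (hpos _ (θhat y).2),
    ENNReal.log_ofReal_of_pos (Real.exp_pos _), ENNReal.log_ofReal_of_pos (Real.exp_pos _),
    Real.log_exp, Real.log_exp] at h1
  norm_cast at h1
  push_cast at h1
  linarith

/-- The `ℓ₁` distance of two nonnegative vectors is controlled by their sums and the distance of
their square roots. -/
theorem l1norm_sub_sq_le {m : ℕ} {f g : Fin m → ℝ} (hf : ∀ j, 0 ≤ f j) (hg : ∀ j, 0 ≤ g j)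
    {L : ℝ} (hfL : ∑ j, f j ≤ L) (hgL : ∑ j, g j ≤ L) :
    l1norm (g - f) ^ 2 ≤ 4 * L * sqrtDistSq f g := by
  have h1 : l1norm (g - f) = ∑ j, |√(f j) - √(g j)| * (√(f j) + √(g j)) := by
    refine Finset.sum_congr rfl fun j _ => ?_
    rw [← abs_of_nonneg (add_nonneg (Real.sqrt_nonneg (f j)) (Real.sqrt_nonneg (g j))), ← abs_mul,
      ← abs_neg]
    congr 1
    rw [Pi.sub_apply]
    linear_combination -Real.sq_sqrt (hf j) + Real.sq_sqrt (hg j)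
  have h2 : ∑ j, (√(f j) + √(g j)) ^ 2 ≤ 4 * L := by
    calc ∑ j, (√(f j) + √(g j)) ^ 2 ≤ ∑ j, (2 * f j + 2 * g j) := by
          refine Finset.sum_le_sum fun j _ => ?_
          nlinarith [Real.sq_sqrt (hf j), Real.sq_sqrt (hg j), sq_nonneg (√(f j) - √(g j))]
      _ = 2 * ∑ j, f j + 2 * ∑ j, g j := by
          rw [Finset.sum_add_distrib, Finset.mul_sum, Finset.mul_sum]
      _ ≤ 4 * L := by linarith
  rw [h1]
  refine (Finset.sum_mul_sq_le_sq_mul_sq _ _ _).trans ?_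
  simp only [sq_abs]
  rw [mul_comm (4 * L)]
  exact mul_le_mul_of_nonneg_left h2 (sqrtDistSq_nonneg f g)

theorem chiSq_le {m : ℕ} {f g : Fin m → ℝ} {c : ℝ} (hc : 0 < c) (hg : ∀ j, c ≤ g j) :
    chiSq f g ≤ l1norm (f - g) ^ 2 / c := by
  calc chiSq f g ≤ ∑ j, |(f - g) j| ^ 2 / c := Finset.sum_le_sum fun j _ => by
        rw [sq_abs, Pi.sub_apply]
        exact div_le_div_of_nonneg_left (sq_nonneg _) hc (hg j)
    _ = (∑ j, |(f - g) j| ^ 2) / c := by rw [Finset.sum_div]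
    _ ≤ l1norm (f - g) ^ 2 / c := by
        gcongr
        exact Finset.sum_sq_le_sq_sum_of_nonneg fun j _ => abs_nonneg _

/-- A penalty satisfying the Kraft inequality tends to infinity, so that any nonnegative function
plus the penalty attains its minimum. -/
theorem exists_isLeast_add_pen {ι : Type*} [Nonempty ι] (pen : ι → ℝ≥0)
    (hKraft : ∑' i, ENNReal.ofReal (Real.exp (-(pen i : ℝ))) ≤ 1) (D : ι → ℝ) (hD : ∀ i, 0 ≤ D i) :
    ∃ i, IsLeast (Set.range fun i => D i + 2 * (pen i : ℝ)) (D i + 2 * (pen i : ℝ)) := by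
  have hfin : Filter.Tendsto (fun i => D i + 2 * (pen i : ℝ)) Filter.cofinite Filter.atTop := by
    refine Filter.tendsto_atTop.2 fun B => ?_
    have := ENNReal.finite_const_le_of_tsum_ne_top (hKraft.trans_lt ENNReal.one_lt_top).ne
      (ENNReal.ofReal_pos.2 (Real.exp_pos (-B))).ne'
    rw [Filter.eventually_cofinite]
    refine this.subset fun i hi => ENNReal.ofReal_le_ofReal (Real.exp_le_exp.2 ?_)
    have h1 := hD i
    have h2 := (pen i).coe_nonneg
    have h3 : D i + 2 * (pen i : ℝ) < B := not_le.1 hi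
    linarith
  obtain ⟨i, hi⟩ := hfin.exists_forall_le
  exact ⟨i, ⟨i, rfl⟩, by rintro _ ⟨i', rfl⟩; exact hi i'⟩

theorem l1norm_nonneg {n : ℕ} (u : Fin n → ℝ) : 0 ≤ l1norm u :=
  Finset.sum_nonneg fun _ _ => abs_nonneg _

theorem l1norm_sub_le_add {n : ℕ} (u v : Fin n → ℝ) : l1norm (u - v) ≤ l1norm u + l1norm v := by
  rw [l1norm, l1norm, l1norm, ← Finset.sum_add_distrib]
  exact Finset.sum_le_sum fun i _ => abs_sub (u i) (v i)

/-- Jensen's inequality for the square of a bounded function on a discrete probability space, with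
a bound on the second moment stated as a Lebesgue integral. -/
theorem integral_le_sqrt_of_sq_le {Ω : Type*} [MeasurableSpace Ω] [Countable Ω]
    [MeasurableSingletonClass Ω] {μ : Measure Ω} [IsProbabilityMeasure μ] {Y H : Ω → ℝ}
    {C K M : ℝ} (hY0 : ∀ y, 0 ≤ Y y) (hYC : ∀ y, Y y ≤ C) (hK : 0 ≤ K) (hM : 0 ≤ M)
    (hYH : ∀ y, Y y ^ 2 ≤ K * H y) (hH : ∫⁻ y, ENNReal.ofReal (H y) ∂μ ≤ ENNReal.ofReal M) :
    ∫ y, Y y ∂μ ≤ √(K * M) := by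
  have hmem : MemLp Y 2 μ := MemLp.of_bound (measurable_of_countable _).aestronglyMeasurable C
    (Filter.Eventually.of_forall fun y => by rw [Real.norm_of_nonneg (hY0 y)]; exact hYC y)
  have h1 := variance_nonneg Y μ
  rw [variance_eq_sub hmem] at h1
  have h2 : ∫ y, (Y ^ 2) y ∂μ ≤ K * M := by
    rw [integral_eq_lintegral_of_nonneg_ae (f := Y ^ 2) (Filter.Eventually.of_forall fun y => sq_nonneg (Y y))
      (measurable_of_countable _).aestronglyMeasurable]
    refine ENNReal.toReal_le_of_le_ofReal (by positivity) ?_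
    calc ∫⁻ y, ENNReal.ofReal ((Y ^ 2) y) ∂μ
        ≤ ∫⁻ y, ENNReal.ofReal K * ENNReal.ofReal (H y) ∂μ := lintegral_mono fun y => by
          rw [← ENNReal.ofReal_mul hK]
          exact ENNReal.ofReal_le_ofReal (hYH y)
      _ = ENNReal.ofReal K * ∫⁻ y, ENNReal.ofReal (H y) ∂μ :=
          lintegral_const_mul _ (measurable_of_countable _)
      _ ≤ ENNReal.ofReal (K * M) := by
          rw [ENNReal.ofReal_mul hK]
          gcongr
  exact Real.le_sqrt_of_sq_le (by linarith)

end PoissonCS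

/-! ### The risk bound -/

theorem mainTheorem2 (n m k d : ℕ) (hk : 1 ≤ k) (hkn : 4 * k ≤ n)
    (E : Finset (Fin n × Fin m)) (hE : PoissonCS.IsExpander E d (2 * k) (1 / 16))
    (L : ℝ) (θstar : Fin n → ℝ) (hθstar : ∀ i, 0 ≤ θstar i) (hL : PoissonCS.l1norm θstar = L)
    (θk : Fin n → ℝ) (hθk : PoissonCS.IsBestKTerm k θstar θk)
    (Θ : Set (Fin n → ℝ)) (hΘcount : Θ.Countable)
    (hΘnonneg : ∀ θ ∈ Θ, ∀ i, 0 ≤ θ i) (hΘL : ∀ θ ∈ Θ, PoissonCS.l1norm θ ≤ L)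
    (pen : Θ → ℝ≥0)
    (hKraft : ∑' θ : Θ, ENNReal.ofReal (Real.exp (-(pen θ : ℝ))) ≤ 1)
    (c : ℝ) (hc : 0 < c)
    (hpos : ∀ θ ∈ Θ, ∀ j, c ≤ (PoissonCS.normAdjMatrix E d).mulVec θ j)
    (θhat : (Fin m → ℕ) → Θ)
    (hθhat : PoissonCS.IsPMLE (PoissonCS.normAdjMatrix E d) Θ pen θhat) :
    Integrable (PoissonCS.l1loss θhat θstar)
      (PoissonCS.poissonLaw ((PoissonCS.normAdjMatrix E d).mulVec θstar)) ∧
    ∃ M : ℝ,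
      IsLeast (Set.range fun θ : Θ =>
        PoissonCS.l1norm (θstar - (θ : Fin n → ℝ)) ^ 2 / c + 2 * (pen θ : ℝ)) M ∧
      PoissonCS.risk (PoissonCS.normAdjMatrix E d) θhat θstar ≤
        4 * PoissonCS.l1norm (θstar - θk) + 8 * Real.sqrt (L * M) := by
  open PoissonCS in
  set Φ := normAdjMatrix E d with hΦ
  have hd : 0 < d := hE.degree_pos (by omega) (by omega)
  have hL0 : 0 ≤ L := hL ▸ l1norm_nonneg θstar
  have : Countable Θ := hΘcount
  have : Nonempty Θ := ⟨θhat 0⟩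
  have hf : ∀ j, 0 ≤ Φ.mulVec θstar j := by
    intro j
    rw [hΦ, normAdjMatrix_mulVec]
    refine mul_nonneg (by positivity) (Finset.sum_nonneg fun i _ => ?_)
    split_ifs
    exacts [hθstar i, le_rfl]
  have hgpos : ∀ θ ∈ Θ, ∀ j, 0 < Φ.mulVec θ j := fun θ hθ j => hc.trans_le (hpos θ hθ j)
  -- On the nonnegative cone `Φ` preserves the `ℓ₁` norm.
  have hsum : ∀ θ : Fin n → ℝ, (∀ i, 0 ≤ θ i) → ∑ j, Φ.mulVec θ j = l1norm θ := fun θ hθ => by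
    rw [hE.sum_mulVec hd]
    exact Finset.sum_congr rfl fun i _ => (abs_of_nonneg (hθ i)).symm
  have hbound : ∀ y, l1norm ((θhat y : Fin n → ℝ) - θstar) ≤ 2 * L := fun y =>
    (l1norm_sub_le_add _ _).trans (by linarith [hΘL _ (θhat y).2])
  have hint : ∀ (Y : (Fin m → ℕ) → ℝ), (∀ y, 0 ≤ Y y) → (∀ y, Y y ≤ 2 * L) →
      Integrable Y (poissonLaw (Φ.mulVec θstar)) := fun Y h0 hY =>
    Integrable.of_bound (measurable_of_countable _).aestronglyMeasurable (2 * L)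
      (Filter.Eventually.of_forall fun y => by rw [Real.norm_of_nonneg (h0 y)]; exact hY y)
  have hloss : Integrable (l1loss θhat θstar) (poissonLaw (Φ.mulVec θstar)) :=
    hint _ (fun _ => l1norm_nonneg _) hbound
  have hΦbound : ∀ y, l1norm (Φ.mulVec ((θhat y : Fin n → ℝ) - θstar)) ≤ 2 * L := fun y =>
    (hE.l1norm_mulVec_le hd _).trans (hbound y)
  refine ⟨hloss, ?_⟩
  obtain ⟨θ₀, hθ₀⟩ := exists_isLeast_add_pen pen hKraft
    (fun θ : Θ => l1norm (θstar - (θ : Fin n → ℝ)) ^ 2 / c)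
    (fun θ => div_nonneg (sq_nonneg _) hc.le)
  refine ⟨_, hθ₀, ?_⟩
  set M := l1norm (θstar - (θ₀ : Fin n → ℝ)) ^ 2 / c + 2 * (pen θ₀ : ℝ) with hM
  have hM0 : 0 ≤ M := add_nonneg (div_nonneg (sq_nonneg _) hc.le) (by positivity)
  have hH : ∫⁻ y, ENNReal.ofReal (sqrtDistSq (Φ.mulVec θstar) (Φ.mulVec (θhat y)))
      ∂(poissonLaw (Φ.mulVec θstar)) ≤ ENNReal.ofReal M := by
    refine (lintegral_sqrtDistSq_le hf (fun θ : Θ => Φ.mulVec θ) (fun θ => hgpos θ θ.2) pen hKraft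
      θhat (hθhat.logLik_le hgpos) θ₀).trans (ENNReal.ofReal_le_ofReal ?_)
    have h1 := chiSq_le (f := Φ.mulVec θstar) hc (hpos θ₀ θ₀.2)
    rw [← Matrix.mulVec_sub] at h1
    have h2 : l1norm (Φ.mulVec (θstar - θ₀)) ^ 2 / c ≤ l1norm (θstar - (θ₀ : Fin n → ℝ)) ^ 2 / c :=
      div_le_div_of_nonneg_right
        (pow_le_pow_left₀ (l1norm_nonneg _) (hE.l1norm_mulVec_le hd _) 2) hc.le
    linarith
  have hmean : ∫ y, l1norm (Φ.mulVec ((θhat y : Fin n → ℝ) - θstar))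
      ∂(poissonLaw (Φ.mulVec θstar)) ≤ √(4 * L * M) := by
    refine integral_le_sqrt_of_sq_le (fun _ => l1norm_nonneg _) hΦbound (by positivity) hM0
      (fun y => ?_) hH
    rw [Matrix.mulVec_sub]
    exact l1norm_sub_sq_le hf (fun j => (hgpos _ (θhat y).2 j).le)
      ((hsum _ hθstar).trans hL).le ((hsum _ (hΘnonneg _ (θhat y).2)).trans_le (hΘL _ (θhat y).2))
  have hsqrt : √(4 * L * M) = 2 * √(L * M) := by
    rw [mul_assoc, Real.sqrt_mul (by norm_num), show (4 : ℝ) = 2 ^ 2 by norm_num,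
      Real.sqrt_sq (by norm_num)]
  have hΦint := hint (fun y => l1norm (Φ.mulVec ((θhat y : Fin n → ℝ) - θstar)))
    (fun _ => l1norm_nonneg _) hΦbound
  have hmono := integral_mono hloss ((integrable_const (4 * l1norm (θstar - θk))).add
    (hΦint.const_mul 4)) fun y => hE.l1norm_sub_le hk (by omega) hd hθk
      ((hΘL _ (θhat y).2).trans hL.ge)
  simp only [Pi.add_apply] at hmono
  rw [integral_add (integrable_const _) (hΦint.const_mul 4), integral_const, integral_const_mul]
    at hmono
  simp only [probReal_univ, one_smul] at hmono
  rw [risk]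
  linarith
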